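/- Let $G$ be a finite simple undirected graph of order $n\ge 1$, not necessarily connected. Let $\omega$ be its clique number, i.e. the number of vertices of a largest clique of $G$. Let $q_1(G)$ be the signless Laplacian spectral radius of $G$, i.e. the largest eigenvalue of $Q(G)=D(G)+A(G)$, where $D(G)$ is the diagonal matrix of vertex degrees and $A(G)$ is the adjacency matrix. Then $$q_1(G)\le 2n\left(1-\frac1\omega\right).$$ Moreover, if $\omega\neq 2$, then equality holds if and only if $G$ is a complete regular $\omega$-partite graph, that is, $G$ is regular and its vertex set can be partitioned into $\omega$ nonempty classes such that two vertices are adjacent if and only if they lie in different classes. -/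

import Mathlib

namespace SignlessLaplacian

/-- The signless Laplacian matrix `Q(G) = D(G) + A(G)` of a finite simple graph. -/
def signlessLapMatrix {V : Type*} [Fintype V] [DecidableEq V]
    (G : SimpleGraph V) [DecidableRel G.Adj] : Matrix V V ℝ :=
  G.degMatrix ℝ + G.adjMatrix ℝ

/-- The set of (real) eigenvalues of the signless Laplacian matrix. -/
def signlessEigenvalues {V : Type*} [Fintype V] [DecidableEq V]
    (G : SimpleGraph V) [DecidableRel G.Adj] : Set ℝ :=
  {μ : ℝ | Module.End.HasEigenvalue (Matrix.toLin' (signlessLapMatrix G)) μ}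

/-- The signless Laplacian spectral radius `q₁(G)`: the largest eigenvalue of `Q(G)`.
The supremum is attained as soon as `G` has a vertex, see `isGreatest_q₁`. -/
noncomputable def q₁ {V : Type*} [Fintype V] [DecidableEq V]
    (G : SimpleGraph V) [DecidableRel G.Adj] : ℝ :=
  sSup (signlessEigenvalues G)

/-- `G` is a complete `k`-partite graph: the vertex set is split into `k` nonempty classes (the
fibres of a surjection onto `Fin k`), and two vertices are adjacent if and only if they lie in
different classes. -/
def IsCompletePartite {V : Type*} (G : SimpleGraph V) (k : ℕ) : Prop :=
  ∃ c : V → Fin k, Function.Surjective c ∧ ∀ u v : V, G.Adj u v ↔ c u ≠ c v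

/-- `G` is a complete regular `k`-partite graph: complete `k`-partite, with all vertices of the
same degree. -/
def IsCompleteRegularPartite {V : Type*} [Fintype V]
    (G : SimpleGraph V) [DecidableRel G.Adj] (k : ℕ) : Prop :=
  IsCompletePartite G k ∧ ∃ d : ℕ, G.IsRegularOfDegree d

theorem isHermitian_signlessLapMatrix {V : Type*} [Fintype V] [DecidableEq V]
    (G : SimpleGraph V) [DecidableRel G.Adj] : (signlessLapMatrix G).IsHermitian := by
  have h : (signlessLapMatrix G).transpose = signlessLapMatrix G := by
    rw [signlessLapMatrix, Matrix.transpose_add, (G.isSymm_degMatrix (R := ℝ)).eq,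
      G.isSymm_adjMatrix.eq]
  rw [Matrix.IsHermitian, Matrix.conjTranspose_eq_transpose_of_trivial, h]

/-- On a nonempty vertex set, `q₁ G` is the largest eigenvalue of `Q(G)`. -/
theorem isGreatest_q₁ {V : Type*} [Fintype V] [DecidableEq V] [Nonempty V]
    (G : SimpleGraph V) [DecidableRel G.Adj] : IsGreatest (signlessEigenvalues G) (q₁ G) := by
  have hA := isHermitian_signlessLapMatrix G
  have hset : signlessEigenvalues G = Set.range hA.eigenvalues := by
    rw [← hA.spectrum_real_eq_range_eigenvalues]
    ext μ
    rw [signlessEigenvalues, Set.mem_ofPred_eq, Module.End.hasEigenvalue_iff_mem_spectrum,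
      Matrix.spectrum_toLin']
  have hfin : (signlessEigenvalues G).Finite := hset ▸ Set.finite_range _
  have hne : (signlessEigenvalues G).Nonempty := hset ▸ Set.range_nonempty _
  exact ⟨hne.csSup_mem hfin, fun _ hx => le_csSup hfin.bddAbove hx⟩

end SignlessLaplacian

/-! The proof is a weighted Motzkin–Straus argument. Fix a vector `y`, put `c = 2(1 - 1/ω)` and `n =
|V|`, and let `B` be `deficitMatrix G c y`. At `p = 1` the form `p ⬝ᵥ B *ᵥ p` equals `2(yᵀQy - c n
‖y‖²)`, so its nonpositivity there, for `y` an eigenvector of `q₁`, is the bound. The diagonal of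
`B` makes the form affine along `e_u - e_v` for nonadjacent `u`, `v`, so weight can be shifted until
the support of `p` is a clique. There Cauchy–Schwarz on at most `ω` vertices leaves at most `-(1 -
2/ω) ∑ p_i p_j (y_i - y_j)²`.

In case of equality with `ω ≥ 3`, replace `y` by `|y|`. The form is nonpositive on the orthant and
vanishes at the interior point `1`, hence `-B` is positive semidefinite and every isotropic vector
lies in its kernel: `1`, and each `e_u - e_v` with `u`, `v` nonadjacent. Reading entries of `B` off
these relations gives that `y` is positive, `G` is complete multipartite, `y` is constant, and `G`
is regular. Conversely, a regular graph has `2d` as an eigenvalue, and the complete partite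
structure forces `ω(n - d) = n`. -/

namespace SignlessLaplacian

open Matrix Finset

/-! ### Quadratic forms on the nonnegative orthant. -/

section QuadraticForm

variable {V : Type*} [Fintype V]

theorem dotProduct_mulVec_add_self {B : Matrix V V ℝ} (hB : B.IsSymm) (p d : V → ℝ) :
    (p + d) ⬝ᵥ B *ᵥ (p + d) = p ⬝ᵥ B *ᵥ p + 2 * (d ⬝ᵥ B *ᵥ p) + d ⬝ᵥ B *ᵥ d := by
  have h : p ⬝ᵥ B *ᵥ d = d ⬝ᵥ B *ᵥ p := by
    rw [dotProduct_comm, dotProduct_mulVec, ← mulVec_transpose, hB.eq, dotProduct_comm,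
      dotProduct_comm]
  rw [mulVec_add, add_dotProduct, dotProduct_add, dotProduct_add, h]
  ring

/-- The Motzkin–Straus reduction: if a quadratic form is affine along every direction
`e_u - e_v` with `u`, `v` distinct and nonadjacent, and is nonpositive on the nonnegative vectors
supported on cliques, then it is nonpositive on all nonnegative vectors. -/
theorem dotProduct_mulVec_self_nonpos_of_clique [DecidableEq V] (G : SimpleGraph V)
    {B : Matrix V V ℝ} (hB : B.IsSymm)
    (haff : ∀ u v, u ≠ v → ¬ G.Adj u v →
      (Pi.single u 1 - Pi.single v 1) ⬝ᵥ B *ᵥ (Pi.single u 1 - Pi.single v 1) = 0)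
    (hclique : ∀ p : V → ℝ, 0 ≤ p →
      G.IsClique (univ.filter fun i => p i ≠ 0 : Finset V) → p ⬝ᵥ B *ᵥ p ≤ 0)
    (p : V → ℝ) (hp : 0 ≤ p) : p ⬝ᵥ B *ᵥ p ≤ 0 := by
  induction hn : #(univ.filter fun i => p i ≠ 0) using Nat.strong_induction_on generalizing p with
  | _ n ih =>
  by_cases hc : G.IsClique (univ.filter fun i => p i ≠ 0 : Finset V)
  · exact hclique p hp hc
  have key : ∀ u v, p u ≠ 0 → p v ≠ 0 → u ≠ v → ¬ G.Adj u v →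
      0 ≤ (Pi.single u 1 - Pi.single v 1 : V → ℝ) ⬝ᵥ B *ᵥ p → p ⬝ᵥ B *ᵥ p ≤ 0 := by
    intro u v hu hv huv hadj hd
    set d : V → ℝ := Pi.single u 1 - Pi.single v 1 with hd_def
    have hval : ∀ i, (p + p v • d) i = if i = u then p u + p v else if i = v then 0 else p i := by
      intro i
      rcases eq_or_ne i u with rfl | hiu
      · simp [hd_def, huv]
      · rcases eq_or_ne i v with rfl | hiv
        · simp [hd_def, hiu]
        · simp [hd_def, hiu, hiv]
    -- All the weight of `v` moves to `u`. The second-order term vanishes, so the sign of the slope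
    -- decides, and `v` leaves the support.
    have hle : p ⬝ᵥ B *ᵥ p ≤ (p + p v • d) ⬝ᵥ B *ᵥ (p + p v • d) := by
      rw [dotProduct_mulVec_add_self hB]
      have hdd : d ⬝ᵥ B *ᵥ d = 0 := haff u v huv hadj
      have := mul_nonneg (hp v) hd
      simp only [mulVec_smul, smul_dotProduct, dotProduct_smul, hdd, smul_eq_mul]
      linarith
    refine hle.trans (ih _ ?_ _ ?_ rfl)
    · rw [← hn]
      apply card_lt_card
      rw [Finset.ssubset_iff_of_subset]
      · exact ⟨v, by simpa using hv, by simp [hval, huv.symm]⟩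
      · intro i
        simp only [mem_filter, mem_univ, true_and, hval]
        split_ifs with h1 h2
        · exact fun _ => h1 ▸ hu
        · simp
        · exact id
    · intro i
      rw [hval, Pi.zero_apply]
      have h1 := hp u
      have h2 := hp v
      have h3 := hp i
      simp only [Pi.zero_apply] at h1 h2 h3
      split_ifs <;> linarith
  simp only [SimpleGraph.IsClique, Set.Pairwise] at hc
  push Not at hc
  obtain ⟨u, hu, v, hv, huv, hadj⟩ := hc
  replace hu : p u ≠ 0 := by simpa using hu
  replace hv : p v ≠ 0 := by simpa using hv
  -- An affine function is nondecreasing in one of the two directions.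
  rcases le_total 0 ((Pi.single u 1 - Pi.single v 1 : V → ℝ) ⬝ᵥ B *ᵥ p) with h | h
  · exact key u v hu hv huv hadj h
  · refine key v u hv hu huv.symm (fun h => hadj h.symm) ?_
    rw [← neg_sub, neg_dotProduct]
    linarith

/-- A quadratic form that is nonpositive on the nonnegative orthant and vanishes at an interior
point of it is negative semidefinite. -/
theorem posSemidef_neg_of_nonpos_of_eq_zero {B : Matrix V V ℝ} (hB : B.IsSymm)
    (hnonpos : ∀ p : V → ℝ, 0 ≤ p → p ⬝ᵥ B *ᵥ p ≤ 0) (hone : (1 : V → ℝ) ⬝ᵥ B *ᵥ 1 = 0) :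
    (-B).PosSemidef := by
  refine PosSemidef.of_dotProduct_mulVec_nonneg ?_ fun d => ?_
  · rw [IsHermitian, conjTranspose_eq_transpose_of_trivial, transpose_neg, hB.eq]
  -- For large `C` both `C • 1 + d` and `C • 1 - d` are nonnegative; adding the two inequalities
  -- cancels the cross terms.
  · obtain ⟨C, hC⟩ : ∃ C : ℝ, ∀ i, |d i| ≤ C :=
      ⟨∑ i, |d i|, fun i => single_le_sum (f := fun i => |d i|)
        (fun i _ => abs_nonneg _) (mem_univ i)⟩
    have h1 := hnonpos (C • 1 + d) fun i => by
      have := abs_le.1 (hC i)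
      simp only [Pi.zero_apply, Pi.add_apply, Pi.smul_apply, Pi.one_apply, smul_eq_mul]
      linarith
    have h2 := hnonpos (C • 1 + -d) fun i => by
      have := abs_le.1 (hC i)
      simp only [Pi.zero_apply, Pi.add_apply, Pi.smul_apply, Pi.one_apply, smul_eq_mul,
        Pi.neg_apply]
      linarith
    rw [dotProduct_mulVec_add_self hB] at h1 h2
    simp only [mulVec_smul, smul_dotProduct, dotProduct_smul, mulVec_neg, neg_dotProduct,
      dotProduct_neg, hone, smul_eq_mul] at h1 h2
    simp only [star_trivial, neg_mulVec, dotProduct_neg]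
    linarith

theorem mulVec_eq_zero_of_posSemidef_neg {B : Matrix V V ℝ} (hB : (-B).PosSemidef) {d : V → ℝ}
    (hd : d ⬝ᵥ B *ᵥ d = 0) : B *ᵥ d = 0 := by
  have := (hB.dotProduct_mulVec_zero_iff d).1 (by simp [neg_mulVec, hd])
  simpa [neg_mulVec] using this

theorem sum_sum_mul_mul_quadratic (p y : V → ℝ) (a b : ℝ) :
    ∑ i, ∑ j, p i * p j * (a * (y i ^ 2 + y j ^ 2) + b * (y i * y j)) =
      2 * a * ((∑ i, p i) * ∑ i, p i * y i ^ 2) + b * (∑ i, p i * y i) ^ 2 := by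
  have h1 : ∑ i, ∑ j, p i * p j * y i ^ 2 = (∑ i, p i) * ∑ i, p i * y i ^ 2 := by
    rw [mul_comm, Finset.sum_mul_sum]
    exact sum_congr rfl fun i _ => sum_congr rfl fun j _ => by ring
  have h2 : ∑ i, ∑ j, p i * p j * y j ^ 2 = (∑ i, p i) * ∑ i, p i * y i ^ 2 := by
    rw [Finset.sum_mul_sum]
    exact sum_congr rfl fun i _ => sum_congr rfl fun j _ => by ring
  have h3 : ∑ i, ∑ j, p i * p j * (y i * y j) = (∑ i, p i * y i) ^ 2 := by
    rw [sq, Finset.sum_mul_sum]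
    exact sum_congr rfl fun i _ => sum_congr rfl fun j _ => by ring
  have h : ∀ i j, p i * p j * (a * (y i ^ 2 + y j ^ 2) + b * (y i * y j)) =
      a * (p i * p j * y i ^ 2) + a * (p i * p j * y j ^ 2) + b * (p i * p j * (y i * y j)) :=
    fun i j => by ring
  simp only [h, sum_add_distrib, ← mul_sum, h1, h2, h3]
  ring

end QuadraticForm

/-- The matrix of the quadratic form
`p ↦ 2 * (∑_{ij ∈ E} p_i p_j (y_i + y_j)² - c (∑ p_i) (∑ p_i y_i²))`. At `p = 1` this compares
twice the form of the signless Laplacian at `y` with `2 c n ‖y‖²`. -/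
def deficitMatrix {V : Type*} (G : SimpleGraph V) [DecidableRel G.Adj] (c : ℝ) (y : V → ℝ) :
    Matrix V V ℝ :=
  Matrix.of fun i j => (if G.Adj i j then (y i + y j) ^ 2 else 0) - c * (y i ^ 2 + y j ^ 2)

theorem deficitMatrix_apply {V : Type*} (G : SimpleGraph V) [DecidableRel G.Adj] (c : ℝ)
    (y : V → ℝ) (i j : V) :
    deficitMatrix G c y i j =
      (if G.Adj i j then (y i + y j) ^ 2 else 0) - c * (y i ^ 2 + y j ^ 2) := rfl

theorem isSymm_deficitMatrix {V : Type*} (G : SimpleGraph V) [DecidableRel G.Adj] (c : ℝ)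
    (y : V → ℝ) : (deficitMatrix G c y).IsSymm := by
  ext i j
  simp only [transpose_apply, deficitMatrix_apply, G.adj_comm j i, add_comm (y j),
    add_comm (y j ^ 2)]

theorem dotProduct_mulVec_self_eq_sum {V : Type*} [Fintype V] (B : Matrix V V ℝ) (p : V → ℝ) :
    p ⬝ᵥ B *ᵥ p = ∑ i, ∑ j, p i * p j * B i j := by
  simp only [dotProduct, mulVec, mul_sum]
  exact sum_congr rfl fun i _ => sum_congr rfl fun j _ => by ring

theorem not_adj_of_cliqueNum_lt_two {V : Type*} [Finite V] {G : SimpleGraph V}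
    (h : G.cliqueNum < 2) (u v : V) : ¬ G.Adj u v := by
  classical
  intro hadj
  have hclique : G.IsClique ({u, v} : Finset V) := by
    simpa [SimpleGraph.isClique_insert] using fun _ => hadj
  have := hclique.card_le_cliqueNum
  rw [card_pair hadj.ne] at this
  omega

/-! ### The deficit form: affine directions, cliques, and its value at `1`. -/

section DeficitForm

variable {V : Type*} [Fintype V] [DecidableEq V] (G : SimpleGraph V) [DecidableRel G.Adj]

theorem dotProduct_deficitMatrix_single_sub_single (c : ℝ) (y : V → ℝ) (u v : V)
    (h : ¬ G.Adj u v) :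
    (Pi.single u 1 - Pi.single v 1) ⬝ᵥ
      deficitMatrix G c y *ᵥ (Pi.single u 1 - Pi.single v 1) = 0 := by
  have h' : ¬ G.Adj v u := fun h' => h h'.symm
  simp only [mulVec_sub, mulVec_single_one, sub_dotProduct, single_dotProduct, one_mul,
    Pi.sub_apply, col_apply, deficitMatrix_apply, h, h', SimpleGraph.irrefl, if_false]
  ring

theorem dotProduct_deficitMatrix_of_isClique {c : ℝ} (y p : V → ℝ)
    (hclique : G.IsClique (univ.filter fun i => p i ≠ 0 : Finset V)) :
    p ⬝ᵥ deficitMatrix G c y *ᵥ p =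
      2 * (1 - c) * ((∑ i, p i) * ∑ i, p i * y i ^ 2) + 2 * (∑ i, p i * y i) ^ 2
        - 4 * ∑ i, (p i * y i) ^ 2 := by
  rw [dotProduct_mulVec_self_eq_sum, ← sum_sum_mul_mul_quadratic, mul_sum, ← sum_sub_distrib]
  refine sum_congr rfl fun i _ => ?_
  have hdiag : 4 * (p i * y i) ^ 2 = ∑ j, if i = j then 4 * (p i * y i) ^ 2 else 0 := by simp
  rw [hdiag, ← sum_sub_distrib]
  refine sum_congr rfl fun j _ => ?_
  rw [deficitMatrix_apply]
  rcases eq_or_ne i j with rfl | hij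
  · simp only [SimpleGraph.irrefl, if_false, if_true]
    ring
  · rcases eq_or_ne (p i) 0 with hi | hi
    · simp [hi]
    rcases eq_or_ne (p j) 0 with hj | hj
    · simp [hj, hij]
    rw [if_pos (hclique (by simpa using hi) (by simpa using hj) hij), if_neg hij]
    ring

/-- Cauchy–Schwarz over the support gives `(∑ p_i y_i)² ≤ r ∑ (p_i y_i)²`; what remains is a
weighted variance of `y`. That term is kept because it forces `y` to be constant in the equality
case, where `r ≥ 3` makes its coefficient nonzero. -/
theorem dotProduct_deficitMatrix_le_of_isClique {r : ℕ} (hr : 2 ≤ r) (y p : V → ℝ)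
    (hclique : G.IsClique (univ.filter fun i => p i ≠ 0 : Finset V))
    (hcard : #(univ.filter fun i => p i ≠ 0) ≤ r) :
    p ⬝ᵥ deficitMatrix G (2 * (1 - 1 / (r : ℝ))) y *ᵥ p ≤
      - ((1 - 2 / (r : ℝ)) * ∑ i, ∑ j, p i * p j * (y i - y j) ^ 2) := by
  have hr0 : (0 : ℝ) < r := by exact_mod_cast (by omega : 0 < r)
  have hS : (∑ i, p i * y i) ^ 2 ≤ r * ∑ i, (p i * y i) ^ 2 := by
    have h1 : ∑ i ∈ univ.filter (fun i => p i ≠ 0), p i * y i = ∑ i, p i * y i :=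
      sum_filter_of_ne fun i _ h => left_ne_zero_of_mul h
    have h2 : ∑ i ∈ univ.filter (fun i => p i ≠ 0), (p i * y i) ^ 2 = ∑ i, (p i * y i) ^ 2 :=
      sum_filter_of_ne fun i _ h => left_ne_zero_of_mul (ne_zero_pow two_ne_zero h)
    rw [← h1, ← h2]
    refine sq_sum_le_card_mul_sum_sq.trans ?_
    gcongr
  have hD : ∑ i, ∑ j, p i * p j * (y i - y j) ^ 2 =
      2 * ((∑ i, p i) * ∑ i, p i * y i ^ 2) - 2 * (∑ i, p i * y i) ^ 2 := by
    have := sum_sum_mul_mul_quadratic p y 1 (-2)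
    rw [mul_one] at this
    rw [sub_eq_add_neg, ← neg_mul, ← this]
    exact sum_congr rfl fun i _ => sum_congr rfl fun j _ => by ring
  rw [dotProduct_deficitMatrix_of_isClique G y p hclique, hD]
  have h3 : 1 / (r : ℝ) * (∑ i, p i * y i) ^ 2 ≤ ∑ i, (p i * y i) ^ 2 := by
    rw [one_div, inv_mul_le_iff₀ hr0]
    exact hS
  have h4 : 2 / (r : ℝ) = 2 * (1 / r) := by ring
  rw [h4]
  linarith

theorem dotProduct_deficitMatrix_nonpos (y p : V → ℝ) (hp : 0 ≤ p) :
    p ⬝ᵥ deficitMatrix G (2 * (1 - 1 / (G.cliqueNum : ℝ))) y *ᵥ p ≤ 0 := by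
  rcases isEmpty_or_nonempty V with hV | hV
  · simp [dotProduct]
  rcases lt_or_ge G.cliqueNum 2 with h2 | h2
  -- For `ω = 1` the graph is edgeless and `c = 0`, so the matrix itself is zero.
  · have hadj : ∀ u v, ¬ G.Adj u v := fun u v => not_adj_of_cliqueNum_lt_two h2 u v
    have h1 : G.cliqueNum = 1 := by
      have : G.IsClique ({Classical.arbitrary V} : Finset V) := by simp
      have := this.card_le_cliqueNum
      rw [card_singleton] at this
      omega
    have : deficitMatrix G (2 * (1 - 1 / (G.cliqueNum : ℝ))) y = 0 := by
      ext i j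
      simp [deficitMatrix_apply, hadj, h1]
    rw [this, zero_mulVec, dotProduct_zero]
  · refine dotProduct_mulVec_self_nonpos_of_clique G (isSymm_deficitMatrix _ _ _)
      (fun u v _ h => dotProduct_deficitMatrix_single_sub_single G _ y u v h) ?_ p hp
    intro p hp hclique
    refine (dotProduct_deficitMatrix_le_of_isClique G h2 y p hclique
      hclique.card_le_cliqueNum).trans (neg_nonpos.2 (mul_nonneg ?_ ?_))
    · have : (2 : ℝ) ≤ G.cliqueNum := by exact_mod_cast h2
      rw [sub_nonneg]
      exact div_le_one_of_le₀ this (by positivity)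
    · exact sum_nonneg fun i _ => sum_nonneg fun j _ =>
        mul_nonneg (mul_nonneg (hp i) (hp j)) (sq_nonneg _)

theorem one_dotProduct_deficitMatrix (c : ℝ) (y : V → ℝ) :
    (1 : V → ℝ) ⬝ᵥ deficitMatrix G c y *ᵥ 1 =
      2 * (y ⬝ᵥ signlessLapMatrix G *ᵥ y) - 2 * (c * Fintype.card V * (y ⬝ᵥ y)) := by
  have hQ : 2 * (y ⬝ᵥ signlessLapMatrix G *ᵥ y) =
      ∑ i, ∑ j, if G.Adj i j then (y i + y j) ^ 2 else 0 := by
    have h1 : y ⬝ᵥ signlessLapMatrix G *ᵥ y =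
        ∑ i, ∑ j, if G.Adj i j then y i ^ 2 + y i * y j else 0 := by
      rw [signlessLapMatrix, add_mulVec]
      refine sum_congr rfl fun i _ => ?_
      rw [Pi.add_apply, SimpleGraph.degMatrix_mulVec_apply, SimpleGraph.adjMatrix_mulVec_apply,
        SimpleGraph.neighborFinset_eq_filter, sum_filter, G.degree_eq_sum_if_adj, sum_mul,
        ← sum_add_distrib, mul_sum]
      refine sum_congr rfl fun j _ => ?_
      split_ifs <;> ring
    have h2 : y ⬝ᵥ signlessLapMatrix G *ᵥ y =
        ∑ i, ∑ j, if G.Adj i j then y j ^ 2 + y i * y j else 0 := by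
      rw [h1, sum_comm]
      refine sum_congr rfl fun i _ => sum_congr rfl fun j _ => ?_
      simp only [G.adj_comm j i, mul_comm (y j)]
    rw [two_mul]
    nth_rw 1 [h1]
    rw [h2, ← sum_add_distrib]
    refine sum_congr rfl fun i _ => ?_
    rw [← sum_add_distrib]
    refine sum_congr rfl fun j _ => ?_
    split_ifs <;> ring
  have hN := sum_sum_mul_mul_quadratic (fun _ : V => 1) y c 0
  simp only [one_mul, zero_mul, add_zero, sum_const, card_univ, nsmul_eq_mul, mul_one] at hN
  rw [dotProduct_mulVec_self_eq_sum, hQ]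
  simp only [Pi.one_apply, one_mul, deficitMatrix_apply, sum_sub_distrib, hN, dotProduct]
  simp only [← sq]
  ring

end DeficitForm

/-! ### The upper bound and a nonnegative extremal vector. -/

theorem exists_dotProduct_eq_q₁ {V : Type*} [Fintype V] [DecidableEq V] [Nonempty V]
    (G : SimpleGraph V) [DecidableRel G.Adj] :
    ∃ x : V → ℝ, x ≠ 0 ∧ x ⬝ᵥ signlessLapMatrix G *ᵥ x = q₁ G * (x ⬝ᵥ x) := by
  obtain ⟨x, hx⟩ := Module.End.HasEigenvalue.exists_hasEigenvector (isGreatest_q₁ G).1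
  refine ⟨x, hx.2, ?_⟩
  have := hx.apply_eq_smul
  rw [toLin'_apply] at this
  rw [this, dotProduct_smul, smul_eq_mul]

theorem dotProduct_self_pos_of_ne_zero {V : Type*} [Fintype V] {x : V → ℝ} (hx : x ≠ 0) :
    0 < x ⬝ᵥ x := by
  simpa using dotProduct_star_self_pos_iff.2 hx

theorem q₁_le {V : Type*} [Fintype V] [DecidableEq V] [Nonempty V]
    (G : SimpleGraph V) [DecidableRel G.Adj] :
    q₁ G ≤ 2 * (Fintype.card V : ℝ) * (1 - 1 / (G.cliqueNum : ℝ)) := by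
  obtain ⟨x, hx, hq⟩ := exists_dotProduct_eq_q₁ G
  have h := dotProduct_deficitMatrix_nonpos G x 1 zero_le_one
  rw [one_dotProduct_deficitMatrix, hq] at h
  refine le_of_mul_le_mul_right ?_ (dotProduct_self_pos_of_ne_zero hx)
  linarith

theorem exists_nonneg_dotProduct_deficitMatrix_eq_zero {V : Type*} [Fintype V] [DecidableEq V]
    [Nonempty V] (G : SimpleGraph V) [DecidableRel G.Adj]
    (h : q₁ G = 2 * (Fintype.card V : ℝ) * (1 - 1 / (G.cliqueNum : ℝ))) :
    ∃ y : V → ℝ, y ≠ 0 ∧ 0 ≤ y ∧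
      (1 : V → ℝ) ⬝ᵥ deficitMatrix G (2 * (1 - 1 / (G.cliqueNum : ℝ))) y *ᵥ 1 = 0 := by
  obtain ⟨x, hx, hq⟩ := exists_dotProduct_eq_q₁ G
  -- Passing to `|x|` keeps the terms in `c` and can only increase the edge terms; the value at `1`
  -- was already maximal.
  refine ⟨|x|, by simpa using hx, abs_nonneg x,
    (dotProduct_deficitMatrix_nonpos G _ 1 zero_le_one).antisymm ?_⟩
  have h0 : (1 : V → ℝ) ⬝ᵥ deficitMatrix G (2 * (1 - 1 / (G.cliqueNum : ℝ))) x *ᵥ 1 = 0 := by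
    rw [one_dotProduct_deficitMatrix, hq, h]
    ring
  rw [← h0, dotProduct_mulVec_self_eq_sum, dotProduct_mulVec_self_eq_sum]
  refine sum_le_sum fun i _ => sum_le_sum fun j _ => ?_
  simp only [Pi.one_apply, one_mul, deficitMatrix_apply, Pi.abs_apply, sq_abs]
  gcongr
  split_ifs
  · rw [← sq_abs (x i + x j)]
    exact pow_le_pow_left₀ (abs_nonneg _) (abs_add_le _ _) 2
  · rfl

/-! ### Complete multipartite graphs and their classes. -/

section CompleteMultipartite

variable {V : Type*} {G : SimpleGraph V}

theorem exists_transversal_of_isCompleteMultipartite (h : G.IsCompleteMultipartite) :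
    ∃ f : V → V, (∀ v, ¬ G.Adj v (f v)) ∧ ∀ u v, f u ≠ f v → G.Adj (f u) (f v) := by
  refine ⟨fun v => (Quotient.mk h.setoid v).out, fun v => ?_, fun u v huv => ?_⟩
  · exact h.setoid.symm (Quotient.mk_out (s := h.setoid) v)
  · by_contra hadj
    exact huv (congrArg Quotient.out (Quotient.out_equiv_out (s := h.setoid).1 hadj))

theorem isCompletePartite_cliqueNum [Finite V] (h : G.IsCompleteMultipartite) :
    IsCompletePartite G G.cliqueNum := by
  classical
  have := Fintype.ofFinite V
  have hmk : ∀ u v, G.Adj u v ↔ Quotient.mk h.setoid u ≠ Quotient.mk h.setoid v := by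
    intro u v
    rw [Ne, Quotient.eq]
    exact not_not.symm
  have := Fintype.ofFinite (Quotient h.setoid)
  have hcard : Fintype.card (Quotient h.setoid) = G.cliqueNum := by
    apply le_antisymm
    · have hclique : G.IsClique
          (univ.map ⟨Quotient.out (s := h.setoid), Quotient.out_injective⟩ : Finset V) := by
        intro u hu v hv huv
        simp only [coe_map, coe_univ, Function.Embedding.coeFn_mk, Set.image_univ,
          Set.mem_range] at hu hv
        obtain ⟨a, rfl⟩ := hu
        obtain ⟨b, rfl⟩ := hv
        rw [hmk, Quotient.out_eq, Quotient.out_eq]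
        exact fun hab => huv (congrArg _ hab)
      simpa using hclique.card_le_cliqueNum
    · obtain ⟨s, hs⟩ := G.exists_isNClique_cliqueNum
      rw [← hs.card_eq]
      refine card_le_card_of_injOn (Quotient.mk h.setoid) (fun _ _ => mem_univ _) ?_
      intro u hu v hv huv
      by_contra hne
      exact (hmk u v).1 (hs.isClique hu hv hne) huv
  let e := Fintype.equivFinOfCardEq hcard
  exact ⟨fun v => e (Quotient.mk h.setoid v), e.surjective.comp Quotient.mk_surjective,
    fun u v => by rw [hmk, e.injective.ne_iff]⟩

end CompleteMultipartite

/-! ### The equality case. -/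

section Equality

variable {V : Type*} [Fintype V] [DecidableEq V] {G : SimpleGraph V} [DecidableRel G.Adj]

/-- If `y z = 0`, each entry of row `z` is at most `(1 - c) y_j²`, so the row sum is negative. The
condition `1 < c` corresponds to `ω > 2`. -/
theorem ne_zero_of_deficitMatrix_mulVec_one {V : Type*} [Fintype V] {G : SimpleGraph V}
    [DecidableRel G.Adj] {c : ℝ} {y : V → ℝ} (hc : 1 < c) (hy : y ≠ 0)
    (h : deficitMatrix G c y *ᵥ 1 = 0) (z : V) : y z ≠ 0 := by
  intro hz
  have h1 : ∑ j, deficitMatrix G c y z j = 0 := by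
    simpa [mulVec, dotProduct] using congrFun h z
  have h2 : ∑ j, deficitMatrix G c y z j ≤ ∑ j, (1 - c) * y j ^ 2 := by
    refine sum_le_sum fun j _ => ?_
    rw [deficitMatrix_apply, hz]
    have := sq_nonneg (y j)
    split_ifs <;> linarith
  have h3 : 0 < y ⬝ᵥ y := dotProduct_self_pos_of_ne_zero hy
  have h4 : y ⬝ᵥ y = ∑ j, y j ^ 2 := sum_congr rfl fun j _ => (sq _).symm
  rw [h1, ← mul_sum, ← h4] at h2
  nlinarith

/-- The vector `e_u - e_v` is isotropic for a semidefinite form, hence in the kernel. -/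
theorem deficitMatrix_apply_eq_of_not_adj {c : ℝ} {y : V → ℝ}
    (hB : (-deficitMatrix G c y).PosSemidef) {u v : V} (h : ¬ G.Adj u v) (k : V) :
    deficitMatrix G c y k u = deficitMatrix G c y k v := by
  have := congrFun (mulVec_eq_zero_of_posSemidef_neg hB
    (dotProduct_deficitMatrix_single_sub_single G c y u v h)) k
  simpa [mulVec_sub, sub_eq_zero] using this

theorem eq_of_not_adj {c : ℝ} {y : V → ℝ} (hc : 0 < c) (hy : 0 ≤ y)
    (hB : (-deficitMatrix G c y).PosSemidef) {u v : V} (h : ¬ G.Adj u v) : y u = y v := by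
  -- In row `u` the two entries are `-2c y_u²` and `-c(y_u² + y_v²)`.
  have := deficitMatrix_apply_eq_of_not_adj hB h u
  simp only [deficitMatrix_apply, SimpleGraph.irrefl, h, if_false, zero_sub, neg_inj] at this
  have := mul_left_cancel₀ hc.ne' this
  exact (pow_left_inj₀ (hy u) (hy v) two_ne_zero).1 (by linarith)

theorem isCompleteMultipartite_of_posSemidef {c : ℝ} {y : V → ℝ} (hc : 0 < c)
    (hy : ∀ v, 0 < y v) (hB : (-deficitMatrix G c y).PosSemidef) :
    G.IsCompleteMultipartite := by
  refine ⟨fun u v w huv hvw huw => ?_⟩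
  -- If `u` were adjacent to `w` but not to `v`, then, since `y v = y w`, the entries in row `u`
  -- would differ by `(y_u + y_w)² > 0`.
  have h1 := deficitMatrix_apply_eq_of_not_adj hB hvw u
  have h2 := eq_of_not_adj hc (fun v => (hy v).le) hB hvw
  simp only [deficitMatrix_apply, huv, huw, if_true, if_false, h2] at h1
  have := pow_pos (add_pos (hy u) (hy w)) 2
  linarith

/-- Concentrating the all-ones vector on one representative per class changes it by kernel vectors
only. The result is a kernel vector supported on a clique, so the variance term in the clique bound
must vanish. -/
theorem eq_of_deficitMatrix_mulVec_one (hr : 3 ≤ G.cliqueNum) {y : V → ℝ} (hy : 0 ≤ y)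
    (hG : G.IsCompleteMultipartite)
    (hB : (-deficitMatrix G (2 * (1 - 1 / (G.cliqueNum : ℝ))) y).PosSemidef)
    (hone : deficitMatrix G (2 * (1 - 1 / (G.cliqueNum : ℝ))) y *ᵥ 1 = 0) (u v : V) :
    y u = y v := by
  have hr' : (3 : ℝ) ≤ G.cliqueNum := by exact_mod_cast hr
  have hc : 0 < 2 * (1 - 1 / (G.cliqueNum : ℝ)) := by
    have : 1 / (G.cliqueNum : ℝ) < 1 := by rw [div_lt_one (by linarith)]; linarith
    linarith
  obtain ⟨f, hf, hff⟩ := exists_transversal_of_isCompleteMultipartite hG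
  -- `p` places the size of each class on its representative.
  set p : V → ℝ := fun i => ∑ v, if f v = i then 1 else 0 with hp_def
  have hp : 0 ≤ p := fun i => sum_nonneg fun v _ => by split_ifs <;> norm_num
  have hpf : ∀ v, 0 < p (f v) := fun v =>
    sum_pos' (fun w _ => by split_ifs <;> norm_num) ⟨v, mem_univ v, by simp⟩
  have hrange : ∀ i, p i ≠ 0 → ∃ v, f v = i := by
    intro i hi
    obtain ⟨v, -, hv⟩ := exists_ne_zero_of_sum_ne_zero hi
    exact ⟨v, by simpa using hv⟩
  have hclique : G.IsClique (univ.filter fun i => p i ≠ 0 : Finset V) := by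
    intro i hi j hj hij
    obtain ⟨a, rfl⟩ := hrange i (by simpa using hi)
    obtain ⟨b, rfl⟩ := hrange j (by simpa using hj)
    exact hff a b hij
  have hBp : deficitMatrix G (2 * (1 - 1 / (G.cliqueNum : ℝ))) y *ᵥ p = 0 := by
    rw [← hone]
    ext k
    simp only [mulVec, dotProduct, hp_def, mul_sum, Pi.one_apply, mul_one]
    rw [sum_comm]
    refine sum_congr rfl fun v _ => ?_
    simp only [mul_ite, mul_one, mul_zero, sum_ite_eq, mem_univ, if_true]
    exact (deficitMatrix_apply_eq_of_not_adj hB (hf v) k).symm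
  have hle := dotProduct_deficitMatrix_le_of_isClique G (by omega) y p hclique
    hclique.card_le_cliqueNum
  rw [hBp, dotProduct_zero, Left.nonneg_neg_iff] at hle
  have hcoef : 0 < 1 - 2 / (G.cliqueNum : ℝ) := by
    have : 2 / (G.cliqueNum : ℝ) < 1 := by rw [div_lt_one (by linarith)]; linarith
    linarith
  have hnonneg : ∀ i j, 0 ≤ p i * p j * (y i - y j) ^ 2 := fun i j =>
    mul_nonneg (mul_nonneg (hp i) (hp j)) (sq_nonneg _)
  have hzero : ∑ i, ∑ j, p i * p j * (y i - y j) ^ 2 = 0 :=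
    (nonpos_of_mul_nonpos_right hle hcoef).antisymm
      (sum_nonneg fun i _ => sum_nonneg fun j _ => hnonneg i j)
  have hterm : p (f u) * p (f v) * (y (f u) - y (f v)) ^ 2 = 0 := by
    rw [sum_eq_zero_iff_of_nonneg fun i _ => sum_nonneg fun j _ => hnonneg i j] at hzero
    have := hzero (f u) (mem_univ _)
    rw [sum_eq_zero_iff_of_nonneg fun j _ => hnonneg _ j] at this
    exact this (f v) (mem_univ _)
  have heq : y (f u) = y (f v) := by
    have := (mul_eq_zero.1 hterm).resolve_left (mul_pos (hpf u) (hpf v)).ne'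
    exact sub_eq_zero.1 (pow_eq_zero_iff two_ne_zero |>.1 this)
  rw [eq_of_not_adj hc hy hB (hf u), heq, eq_of_not_adj hc hy hB (hf v)]

theorem isRegularOfDegree_of_deficitMatrix_mulVec_one {V : Type*} [Fintype V] {G : SimpleGraph V}
    [DecidableRel G.Adj] [Nonempty V] {c : ℝ} {y : V → ℝ}
    (hy : ∀ v, 0 < y v) (hconst : ∀ u v, y u = y v) (h : deficitMatrix G c y *ᵥ 1 = 0) :
    ∃ d : ℕ, G.IsRegularOfDegree d := by
  obtain ⟨w⟩ := ‹Nonempty V›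
  -- With `y` constant, the vanishing of row sum `k` determines the degree of `k`.
  have hdeg : ∀ k, (G.degree k : ℝ) * (4 * y w ^ 2) = Fintype.card V * (c * (2 * y w ^ 2)) := by
    intro k
    have h1 : ∑ j, deficitMatrix G c y k j = 0 := by
      simpa [mulVec, dotProduct] using congrFun h k
    have h2 : ∀ j, deficitMatrix G c y k j =
        (if G.Adj k j then 1 else 0) * (4 * y w ^ 2) - c * (2 * y w ^ 2) := by
      intro j
      rw [deficitMatrix_apply, hconst k w, hconst j w]
      split_ifs <;> ring
    simp only [h2, sum_sub_distrib, ← sum_mul, ← G.degree_eq_sum_if_adj, sum_const, card_univ,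
      nsmul_eq_mul] at h1
    linarith
  refine ⟨G.degree w, fun k => ?_⟩
  have h4 : (4 * y w ^ 2) ≠ 0 := by
    have := pow_pos (hy w) 2
    positivity
  exact_mod_cast mul_right_cancel₀ h4 ((hdeg k).trans (hdeg w).symm)

theorem isCompleteRegularPartite_of_q₁_eq [Nonempty V] (hr : G.cliqueNum ≠ 2)
    (h : q₁ G = 2 * (Fintype.card V : ℝ) * (1 - 1 / (G.cliqueNum : ℝ))) :
    IsCompleteRegularPartite G G.cliqueNum := by
  rcases lt_or_ge G.cliqueNum 2 with h2 | h2
  · have hadj : ∀ u v, ¬ G.Adj u v := fun u v => not_adj_of_cliqueNum_lt_two h2 u v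
    -- An edgeless graph is complete multipartite with a single class.
    refine ⟨isCompletePartite_cliqueNum ⟨fun u _ w _ _ => hadj u w⟩, 0, fun v => ?_⟩
    rw [SimpleGraph.degree_eq_zero]
    exact fun w => hadj v w
  · obtain ⟨y, hy0, hy, hyone⟩ := exists_nonneg_dotProduct_deficitMatrix_eq_zero G h
    have hr3 : 3 ≤ G.cliqueNum := by omega
    have hc : 1 < 2 * (1 - 1 / (G.cliqueNum : ℝ)) := by
      have hr' : (3 : ℝ) ≤ G.cliqueNum := by exact_mod_cast hr3
      have : 1 / (G.cliqueNum : ℝ) ≤ 1 / 3 := one_div_le_one_div_of_le (by norm_num) hr'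
      linarith
    have hB := posSemidef_neg_of_nonpos_of_eq_zero (isSymm_deficitMatrix G _ y)
      (dotProduct_deficitMatrix_nonpos G y) hyone
    have hone := mulVec_eq_zero_of_posSemidef_neg hB hyone
    have hpos : ∀ v, 0 < y v := fun v =>
      (hy v).lt_of_ne (ne_zero_of_deficitMatrix_mulVec_one hc hy0 hone v).symm
    have hG := isCompleteMultipartite_of_posSemidef (by linarith) hpos hB
    exact ⟨isCompletePartite_cliqueNum hG, isRegularOfDegree_of_deficitMatrix_mulVec_one hpos
      (eq_of_deficitMatrix_mulVec_one hr3 hy hG hB hone) hone⟩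

theorem two_mul_degree_le_q₁ [Nonempty V] {d : ℕ} (h : G.IsRegularOfDegree d) :
    2 * (d : ℝ) ≤ q₁ G := by
  refine (isGreatest_q₁ G).2 (Module.End.hasEigenvalue_of_hasEigenvector (x := 1)
    ⟨Module.End.mem_eigenspace_iff.2 ?_, one_ne_zero⟩)
  rw [toLin'_apply]
  ext v
  rw [signlessLapMatrix, add_mulVec, Pi.add_apply, SimpleGraph.degMatrix_mulVec_apply,
    SimpleGraph.adjMatrix_mulVec_apply]
  simp [h.degree_eq v]
  ring

/-- The class of a vertex is the complement of its neighbourhood, so all `k` classes have size `n -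
d`. -/
theorem mul_card_sub_degree_eq_card {V : Type*} [Fintype V] {G : SimpleGraph V}
    [DecidableRel G.Adj] {k d : ℕ} (h : IsCompletePartite G k)
    (hd : G.IsRegularOfDegree d) : (k : ℝ) * (Fintype.card V - d) = Fintype.card V := by
  obtain ⟨c, hc, hadj⟩ := h
  have hfib : ∀ i, (#(univ.filter fun v => c v = i) : ℝ) = Fintype.card V - d := by
    intro i
    obtain ⟨u, rfl⟩ := hc i
    have h1 : #(univ.filter fun v => c v = c u) + #(univ.filter fun v => ¬ c v = c u) =
        Fintype.card V := card_filter_add_card_filter_not _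
    have h2 : (univ.filter fun v => ¬ c v = c u) = G.neighborFinset u := by
      ext v
      simp [hadj, eq_comm]
    rw [h2, SimpleGraph.card_neighborFinset_eq_degree, hd.degree_eq u] at h1
    rw [← h1]
    push_cast
    ring
  have hsum : ∑ i, (#(univ.filter fun v => c v = i) : ℝ) = Fintype.card V := by
    rw [← card_univ, card_eq_sum_card_fiberwise (f := c) (t := univ) fun _ _ => mem_univ _]
    push_cast
    rfl
  simpa only [hfib, sum_const, card_univ, Fintype.card_fin, nsmul_eq_mul] using hsum

theorem q₁_eq_of_isCompleteRegularPartite [Nonempty V]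
    (h : IsCompleteRegularPartite G G.cliqueNum) :
    q₁ G = 2 * (Fintype.card V : ℝ) * (1 - 1 / (G.cliqueNum : ℝ)) := by
  obtain ⟨hG, d, hd⟩ := h
  refine (q₁_le G).antisymm (le_of_eq_of_le ?_ (two_mul_degree_le_q₁ hd))
  have hmul := mul_card_sub_degree_eq_card hG hd
  have h0 : (G.cliqueNum : ℝ) ≠ 0 := by
    intro h0
    rw [h0, zero_mul] at hmul
    exact Fintype.card_ne_zero (α := V) (by exact_mod_cast hmul.symm)
  field_simp
  linarith

end Equality

end SignlessLaplacian

theorem corollary2p8 {V : Type*} [Fintype V] [DecidableEq V] [Nonempty V]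
    (G : SimpleGraph V) [DecidableRel G.Adj] :
    SignlessLaplacian.q₁ G ≤ 2 * (Fintype.card V : ℝ) * (1 - 1 / (G.cliqueNum : ℝ)) ∧
    (G.cliqueNum ≠ 2 →
      (SignlessLaplacian.q₁ G = 2 * (Fintype.card V : ℝ) * (1 - 1 / (G.cliqueNum : ℝ)) ↔
        SignlessLaplacian.IsCompleteRegularPartite G G.cliqueNum)) :=
  ⟨SignlessLaplacian.q₁_le G, fun hr =>
    ⟨SignlessLaplacian.isCompleteRegularPartite_of_q₁_eq hr,
      SignlessLaplacian.q₁_eq_of_isCompleteRegularPartite⟩⟩
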